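/- Let $\Omega\subset\mathbb R^n$ be a bounded open set (for instance a bounded domain with Lipschitz boundary; no regularity of the boundary is needed). Let $H^1(\Omega)$ be the usual Sobolev space with norm $\|u\|_{H^1}^2=\|u\|_{L^2}^2+\sum_i\|\partial_i u\|_{L^2}^2$, and let $H^1_0(\Omega)$ be the closure of $C_c^\infty(\Omega)$ in it. Let $a_{i,j},d_i,b\in L^\infty(\Omega)$ and $$a(y,v)=\int_\Omega \sum_{i,j}a_{i,j}\,\partial_i y\,\partial_j v+\sum_i d_i(\partial_i y\,v+y\,\partial_i v)+b\,y\,v\;dx ,$$ and assume that $a$ is elliptic: there is $K>0$ with $a(y,y)\ge K\|y\|_{H^1}^2$ for all $y\in H^1_0(\Omega)$ (symmetry is not assumed). Let $\varphi\in H^1(\Omega)$, $f,\bar\lambda\in L^2(\Omega)$, and let $\max_\gamma:\mathbb R\to\mathbb R$ $(\gamma>0)$ satisfy: (i) $\max_\gamma\in C^1(\mathbb R)$ for every $\gamma>0$; (ii) there is $g:(0,\infty)\to[0,\infty)$ with $g(\gamma)\to0$ as $\gamma\to\infty$ and $|\max_\gamma(x)-\max(0,x)|\le g(\gamma)$ for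 all $x\in\mathbb R$, $\gamma>0$; (iii) for every $\gamma>0$, $\max_\gamma'$ takes values in $[0,1]$ and is nondecreasing; (iv) for every $\delta>0$, as $\gamma\to\infty$, $\max_\gamma'$ converges uniformly to $0$ on $(-\infty,-\delta)$ and to $1$ on $(\delta,\infty)$. Then: (1) For all $\gamma,c>0$ the fully regularized state equation $$a(y,v)+\big(\textstyle\max_\gamma(\bar\lambda+c(y-\varphi)),v\big)_{L^2(\Omega)}=(f,v)_{L^2(\Omega)}\qquad\forall v\in H^1_0(\Omega)$$ has a unique solution $y_{\gamma,c}\in H^1_0(\Omega)$. (2) For all $c>0$ the regularized state equation $$a(y,v)+\big(\max(0,\bar\lambda+c(y-\varphi)),v\big)_{L^2(\Omega)}=(f,v)_{L^2(\Omega)}\qquad\forall v\in H^1_0(\Omega)$$ has a unique solution $y_c\in H^1_0(\Omega)$. (3) For every $c>0$, $y_{\gamma,c}\to y_c$ in $H^1(\Omega)$ as $\gamma\to\infty$. (4) $y_c\to y$ in $H^1(\Omega)$ as $c\to\infty$ for every solution $y$ of the obstacle problem, in either formulation: (a) $y\in K:=\{\theta\in H^1_0(\Omega):\theta\le\varphi\text{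 a.e. in }\Omega\}$ and $a(y,v-y)\ge(f,v-y)_{L^2(\Omega)}$ for all $v\in K$; or (b) $y\in H^1_0(\Omega)$ and there is $\lambda\in L^2(\Omega)$ with $a(y,v)+(\lambda,v)_{L^2(\Omega)}=(f,v)_{L^2(\Omega)}$ for all $v\in H^1_0(\Omega)$ and $\lambda\ge0$, $y\le\varphi$, $\lambda(y-\varphi)=0$ a.e. in $\Omega$. -/

import Mathlib

open MeasureTheory Filter Topology TopologicalSpace
open scoped ENNReal ContDiff

noncomputable section

namespace ObstacleProblem

/-- The Lebesgue measure on the open set `Ω ⊆ ℝⁿ`. -/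
abbrev vol {n : ℕ} (Ω : Opens (EuclideanSpace ℝ (Fin n))) : Measure (EuclideanSpace ℝ (Fin n)) :=
  volume.restrict (Ω : Set (EuclideanSpace ℝ (Fin n)))

/-- The Lebesgue space `L²(Ω)`. -/
abbrev L2 {n : ℕ} (Ω : Opens (EuclideanSpace ℝ (Fin n))) : Type := Lp ℝ 2 (vol Ω)

/-- The Lebesgue space `L^∞(Ω)`. -/
abbrev LInf {n : ℕ} (Ω : Opens (EuclideanSpace ℝ (Fin n))) : Type := Lp ℝ ∞ (vol Ω)

/-- The Hilbert space `L²(Ω) × L²(Ω)ⁿ` with the norm `(‖u‖² + ∑ i, ‖g i‖²)^(1/2)`. -/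
abbrev L2Pair {n : ℕ} (Ω : Opens (EuclideanSpace ℝ (Fin n))) : Type :=
  WithLp 2 (L2 Ω × PiLp 2 (fun _ : Fin n => L2 Ω))

/-- The `i`-th classical partial derivative of a function on `ℝⁿ`. -/
def partialDeriv {n : ℕ} (i : Fin n) (ψ : EuclideanSpace ℝ (Fin n) → ℝ)
    (x : EuclideanSpace ℝ (Fin n)) : ℝ :=
  fderiv ℝ ψ x (EuclideanSpace.single i 1)

/-- `g` is the `i`-th weak partial derivative of `u` on `Ω`; the test functions are the smooth
functions with compact support contained in `Ω`. -/
def IsWeakPartialDeriv {n : ℕ} {Ω : Opens (EuclideanSpace ℝ (Fin n))} (i : Fin n)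
    (u g : L2 Ω) : Prop :=
  ∀ ψ : TestFunction Ω ℝ ⊤,
    ∫ x, u x * partialDeriv i ψ x ∂(vol Ω) = - ∫ x, g x * ψ x ∂(vol Ω)

theorem memLp_testFunction {n : ℕ} {Ω : Opens (EuclideanSpace ℝ (Fin n))}
    (ψ : TestFunction Ω ℝ ⊤) : MemLp ψ 2 (vol Ω) :=
  (ψ.contDiff.continuous.memLp_of_hasCompactSupport ψ.hasCompactSupport).restrict _

theorem memLp_partialDeriv {n : ℕ} {Ω : Opens (EuclideanSpace ℝ (Fin n))} (i : Fin n)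
    (ψ : TestFunction Ω ℝ ⊤) : MemLp (partialDeriv i ψ) 2 (vol Ω) := by
  have hc : Continuous (partialDeriv i ψ) :=
    (ψ.contDiff.continuous_fderiv (by simp)).clm_apply continuous_const
  exact (hc.memLp_of_hasCompactSupport
    (ψ.hasCompactSupport.fderiv_apply (𝕜 := ℝ) _)).restrict _

theorem IsWeakPartialDeriv.add {n : ℕ} {Ω : Opens (EuclideanSpace ℝ (Fin n))} {i : Fin n}
    {u g u' g' : L2 Ω} (h : IsWeakPartialDeriv i u g) (h' : IsWeakPartialDeriv i u' g') :
    IsWeakPartialDeriv i (u + u') (g + g') := by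
  intro ψ
  have key : ∀ (w w' : L2 Ω) (θ : EuclideanSpace ℝ (Fin n) → ℝ), MemLp θ 2 (vol Ω) →
      ∫ x, (w + w' : L2 Ω) x * θ x ∂(vol Ω)
        = ∫ x, w x * θ x ∂(vol Ω) + ∫ x, w' x * θ x ∂(vol Ω) := by
    intro w w' θ hθ
    have h1 : Integrable (fun x => w x * θ x) (vol Ω) := (Lp.memLp w).integrable_mul hθ
    have h2 : Integrable (fun x => w' x * θ x) (vol Ω) := (Lp.memLp w').integrable_mul hθ
    rw [← integral_add h1 h2]
    refine integral_congr_ae ?_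
    filter_upwards [Lp.coeFn_add w w'] with x hx
    rw [hx, Pi.add_apply, add_mul]
  rw [key _ _ _ (memLp_partialDeriv i ψ), key _ _ _ (memLp_testFunction ψ), h ψ, h' ψ]
  ring

theorem IsWeakPartialDeriv.smul {n : ℕ} {Ω : Opens (EuclideanSpace ℝ (Fin n))} {i : Fin n}
    {u g : L2 Ω} (r : ℝ) (h : IsWeakPartialDeriv i u g) :
    IsWeakPartialDeriv i (r • u) (r • g) := by
  intro ψ
  have key : ∀ (w : L2 Ω) (θ : EuclideanSpace ℝ (Fin n) → ℝ),
      ∫ x, (r • w : L2 Ω) x * θ x ∂(vol Ω) = r * ∫ x, w x * θ x ∂(vol Ω) := by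
    intro w θ
    rw [← integral_const_mul]
    refine integral_congr_ae ?_
    filter_upwards [Lp.coeFn_smul r w] with x hx
    simp [hx, mul_assoc]
  rw [key, key, h ψ]
  ring

theorem IsWeakPartialDeriv.zero {n : ℕ} {Ω : Opens (EuclideanSpace ℝ (Fin n))} {i : Fin n} :
    IsWeakPartialDeriv i (0 : L2 Ω) 0 := by
  intro ψ
  have key : ∀ θ : EuclideanSpace ℝ (Fin n) → ℝ, ∫ x, (0 : L2 Ω) x * θ x ∂(vol Ω) = 0 := by
    intro θ
    refine integral_eq_zero_of_ae ?_
    filter_upwards [Lp.coeFn_zero ℝ 2 (vol Ω)] with x hx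
    rw [hx, Pi.zero_apply, zero_mul]
  rw [key, key, neg_zero]

/-- The Sobolev space `H¹(Ω)`: pairs of a function in `L²(Ω)` and its weak gradient in `L²(Ω)ⁿ`,
with the norm `(‖u‖² + ∑ i, ‖∂ᵢ u‖²)^(1/2)` inherited from `L²(Ω) × L²(Ω)ⁿ`. -/
def H1 {n : ℕ} (Ω : Opens (EuclideanSpace ℝ (Fin n))) : Submodule ℝ (L2Pair Ω) where
  carrier := {p | ∀ i, IsWeakPartialDeriv i p.fst (p.snd i)}
  add_mem' hp hq i := (hp i).add (hq i)
  zero_mem' _ := IsWeakPartialDeriv.zero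
  smul_mem' r _ hp i := (hp i).smul r

/-- The function underlying an element of `H¹(Ω)`. -/
def fn {n : ℕ} {Ω : Opens (EuclideanSpace ℝ (Fin n))} (u : H1 Ω) : L2 Ω :=
  (u : L2Pair Ω).fst

/-- The `i`-th weak partial derivative of an element of `H¹(Ω)`. -/
def weakDeriv {n : ℕ} {Ω : Opens (EuclideanSpace ℝ (Fin n))} (u : H1 Ω) (i : Fin n) : L2 Ω :=
  (u : L2Pair Ω).snd i

/-- The subspace of `H¹(Ω)` of (classes of) smooth functions with compact support in `Ω`. -/
def smoothCompactlySupported {n : ℕ} (Ω : Opens (EuclideanSpace ℝ (Fin n))) :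
    Submodule ℝ (H1 Ω) where
  carrier := {u | ∃ ψ : TestFunction Ω ℝ ⊤, fn u =ᵐ[vol Ω] ψ}
  add_mem' := by
    rintro u v ⟨ψ, hψ⟩ ⟨θ, hθ⟩
    refine ⟨ψ + θ, ?_⟩
    filter_upwards [Lp.coeFn_add (fn u) (fn v), hψ, hθ] with x hx h1 h2
    change (fn u + fn v : L2 Ω) x = _
    rw [hx, Pi.add_apply, h1, h2]
    rfl
  zero_mem' := by
    refine ⟨0, ?_⟩
    filter_upwards [Lp.coeFn_zero ℝ 2 (vol Ω)] with x hx
    change (0 : L2 Ω) x = _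
    rw [hx]
    rfl
  smul_mem' := by
    rintro r u ⟨ψ, hψ⟩
    refine ⟨r • ψ, ?_⟩
    filter_upwards [Lp.coeFn_smul r (fn u), hψ] with x hx h1
    change (r • fn u : L2 Ω) x = _
    simp [hx, h1]

/-- The Sobolev space `H¹₀(Ω)`: the closure in `H¹(Ω)` of the smooth functions with compact
support in `Ω`. -/
def H10 {n : ℕ} (Ω : Opens (EuclideanSpace ℝ (Fin n))) : Submodule ℝ (H1 Ω) :=
  (smoothCompactlySupported Ω).topologicalClosure

/-- Coefficient functions `a i j`, `d i`, `b` in `L^∞(Ω)`. -/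
structure Coefficients {n : ℕ} (Ω : Opens (EuclideanSpace ℝ (Fin n))) where
  a : Fin n → Fin n → LInf Ω
  d : Fin n → LInf Ω
  b : LInf Ω

/-- The bilinear form
`∫_Ω ∑ i j, a i j ∂ᵢ y ∂ⱼ v + ∑ i, d i (∂ᵢ y v + y ∂ᵢ v) + b y v dx`. -/
def Coefficients.form {n : ℕ} {Ω : Opens (EuclideanSpace ℝ (Fin n))} (A : Coefficients Ω)
    (y v : H1 Ω) : ℝ :=
  ∫ x, ((∑ i, ∑ j, A.a i j x * weakDeriv y i x * weakDeriv v j x)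
      + (∑ i, A.d i x * (weakDeriv y i x * fn v x + fn y x * weakDeriv v i x))
      + A.b x * fn y x * fn v x) ∂(vol Ω)

/-- The bilinear form is (strongly) elliptic, that is, coercive on `H¹₀(Ω)`. -/
def Coefficients.IsElliptic {n : ℕ} {Ω : Opens (EuclideanSpace ℝ (Fin n))}
    (A : Coefficients Ω) : Prop :=
  ∃ K : ℝ, 0 < K ∧ ∀ y : H10 Ω, K * ‖(y : H1 Ω)‖ ^ 2 ≤ A.form y y

/-- The assumptions on a family `m γ` (`γ > 0`) of smoothed max-functions. Values at `γ ≤ 0` are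
irrelevant. -/
structure IsSmoothedMax (m : ℝ → ℝ → ℝ) : Prop where
  contDiff : ∀ γ : ℝ, 0 < γ → ContDiff ℝ 1 (m γ)
  approx : ∃ g : ℝ → ℝ, (∀ γ : ℝ, 0 < γ → 0 ≤ g γ) ∧ Tendsto g atTop (𝓝 0) ∧
    ∀ γ : ℝ, 0 < γ → ∀ x : ℝ, |m γ x - max 0 x| ≤ g γ
  deriv_mem : ∀ γ : ℝ, 0 < γ → ∀ x : ℝ, deriv (m γ) x ∈ Set.Icc (0 : ℝ) 1
  deriv_mono : ∀ γ : ℝ, 0 < γ → Monotone (deriv (m γ))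
  deriv_neg : ∀ δ : ℝ, 0 < δ →
    TendstoUniformlyOn (fun γ => deriv (m γ)) (fun _ => 0) atTop (Set.Iio (-δ))
  deriv_pos : ∀ δ : ℝ, 0 < δ →
    TendstoUniformlyOn (fun γ => deriv (m γ)) (fun _ => 1) atTop (Set.Ioi δ)

/-- `y ∈ H¹₀(Ω)` solves `a(y, v) + (β(lam + c (y - φ)), v) = (f, v)` for all `v ∈ H¹₀(Ω)`, with
`L²(Ω)` scalar products. -/
def SolvesPenalized {n : ℕ} {Ω : Opens (EuclideanSpace ℝ (Fin n))} (A : Coefficients Ω)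
    (φ : H1 Ω) (f lam : L2 Ω) (β : ℝ → ℝ) (c : ℝ) (y : H10 Ω) : Prop :=
  ∀ v : H10 Ω,
    A.form y v + ∫ x, β (lam x + c * (fn (y : H1 Ω) x - fn φ x)) * fn (v : H1 Ω) x ∂(vol Ω)
      = ∫ x, f x * fn (v : H1 Ω) x ∂(vol Ω)

/-- The regularized state equation. -/
def SolvesRegularized {n : ℕ} {Ω : Opens (EuclideanSpace ℝ (Fin n))} (A : Coefficients Ω)
    (φ : H1 Ω) (f lam : L2 Ω) (c : ℝ) (y : H10 Ω) : Prop :=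
  SolvesPenalized A φ f lam (fun t => max 0 t) c y

/-- The fully regularized state equation. -/
def SolvesFullyRegularized {n : ℕ} {Ω : Opens (EuclideanSpace ℝ (Fin n))} (A : Coefficients Ω)
    (φ : H1 Ω) (f lam : L2 Ω) (m : ℝ → ℝ → ℝ) (γ c : ℝ) (y : H10 Ω) : Prop :=
  SolvesPenalized A φ f lam (m γ) c y

/-- The admissible set `K = {θ ∈ H¹₀(Ω) : θ ≤ φ almost everywhere in Ω}`. -/
def admissible {n : ℕ} {Ω : Opens (EuclideanSpace ℝ (Fin n))} (φ : H1 Ω) : Set (H10 Ω) :=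
  {θ | ∀ᵐ x ∂(vol Ω), fn (θ : H1 Ω) x ≤ fn φ x}

/-- The obstacle problem: `y ∈ K` and `a(y, v - y) ≥ (f, v - y)` for all `v ∈ K`. -/
def SolvesObstacle {n : ℕ} {Ω : Opens (EuclideanSpace ℝ (Fin n))} (A : Coefficients Ω)
    (φ : H1 Ω) (f : L2 Ω) (y : H10 Ω) : Prop :=
  y ∈ admissible φ ∧ ∀ v ∈ admissible φ,
    ∫ x, f x * fn ((v - y : H10 Ω) : H1 Ω) x ∂(vol Ω) ≤ A.form y ((v - y : H10 Ω) : H1 Ω)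

/-- The obstacle problem as a complementarity system for `y ∈ H¹₀(Ω)` with a multiplier
`l ∈ L²(Ω)`: `a(y, v) + (l, v) = (f, v)` for all `v ∈ H¹₀(Ω)`, and `l ≥ 0`, `y ≤ φ`,
`l (y - φ) = 0` almost everywhere in `Ω`. -/
def SolvesComplementarity {n : ℕ} {Ω : Opens (EuclideanSpace ℝ (Fin n))} (A : Coefficients Ω)
    (φ : H1 Ω) (f : L2 Ω) (y : H10 Ω) (l : L2 Ω) : Prop :=
  (∀ v : H10 Ω, A.form y v + ∫ x, l x * fn (v : H1 Ω) x ∂(vol Ω)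
      = ∫ x, f x * fn (v : H1 Ω) x ∂(vol Ω)) ∧
  (∀ᵐ x ∂(vol Ω), 0 ≤ l x) ∧
  (∀ᵐ x ∂(vol Ω), fn (y : H1 Ω) x ≤ fn φ x) ∧
  (∀ᵐ x ∂(vol Ω), l x * (fn (y : H1 Ω) x - fn φ x) = 0)

end ObstacleProblem

end

open ObstacleProblem

/-! Abstractly, the data are a coercive bounded bilinear form B on a Hilbert space V (here H¹₀(Ω))
and a bounded operator T from V to L² of a finite measure (here the inclusion). The penalty terms
are nondecreasing and Lipschitz, so each regularized equation reads F y = T*f with F strongly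
monotone and Lipschitz, and Zarantonello's theorem (`existsUnique_eq_of_stronglyMonotone`) solves
it. For two penalties, the difference of the solutions is controlled by the sup distance of the
penalties, since monotonicity gives the remaining term a sign; this settles γ → ∞.

For c → ∞ put P_c = max(0, lam + c(T y_c - φ)). The pointwise inequality `max_sub_mul_le` and
polarization give (P_c - l, T(y_c - y)) ≥ -‖l - lam‖²/(4c) whenever l ≥ 0, T y ≤ φ and l(T y - φ) =
0. With the multiplier l of the complementarity system, coercivity then yields K‖y_c - y‖² ≤ ‖l -
lam‖²/(4c). The variational inequality need not provide a multiplier in L², so l = 0 is used; this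
leaves the extra term ℓ(y_c - y) with ℓ = (f, T·) - B(y, ·). A weak limit z of the bounded family
y_c satisfies T z ≤ φ, so ℓ(z - y) ≤ 0 by the variational inequality, and the same estimate upgrades
weak to strong convergence. -/

/-! ### Elementary inequalities, strongly monotone operators and weak limits -/

section Hilbert

/-- Write P = max(0, p) and c(w - y) = p - lam + c(φ - y). Since P² = P p and l(y - φ) = 0, right
side minus left side is l(P - p) + c P(φ - y), a sum of nonnegative terms. -/
theorem max_sub_mul_le {p l lam c w y φ : ℝ} (hp : p = lam + c * (w - φ)) (hc : 0 < c)
    (hl : 0 ≤ l) (hy : y ≤ φ) (hly : l * (y - φ) = 0) :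
    (max 0 p - l) * (max 0 p - lam) ≤ c * ((max 0 p - l) * (w - y)) := by
  have h1 : 0 ≤ max 0 p := le_max_left _ _
  have h2 : max 0 p * max 0 p = max 0 p * p := by
    rcases le_total 0 p with h | h <;> simp [h]
  have h3 : l * p ≤ l * max 0 p := mul_le_mul_of_nonneg_left (le_max_right _ _) hl
  have h4 : 0 ≤ c * (max 0 p * (φ - y)) := by
    have := sub_nonneg.2 hy
    positivity
  have h5 : c * (l * (y - φ)) = 0 := by rw [hly, mul_zero]
  have h6 : c * w = p - lam + c * φ := by rw [hp]; ring
  have h7 : c * ((max 0 p - l) * (w - y)) = (max 0 p - l) * (c * w - c * y) := by ring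
  rw [h7, h6]
  nlinarith

/-- Polarization: 4(a, b) = ‖a + b‖² - ‖a - b‖². The bound is independent of p, so no estimate of
the penalty term is needed. -/
theorem neg_norm_sub_sq_le_inner {E : Type*} [NormedAddCommGroup E] [InnerProductSpace ℝ E]
    (p l m : E) : -(‖l - m‖ ^ 2 / 4) ≤ inner ℝ (p - l) (p - m) := by
  have h := sq_nonneg ‖(p - l) + (p - m)‖
  rw [norm_add_sq_real] at h
  have h' : ‖l - m‖ ^ 2 = ‖(p - m) - (p - l)‖ ^ 2 := by congr 2; abel
  rw [norm_sub_sq_real (p - m), real_inner_comm] at h'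
  linarith

/-- The squares force s₀ ≥ 0, so only the sign s₀ ≤ 0 has to be known; this is all the variational
inequality gives about a weak limit. -/
theorem tendsto_of_sq_le {ι E : Type*} [SeminormedAddCommGroup E] {F : Filter ι} {y : ι → E}
    {z : E} {K : ℝ} (hK : 0 < K)
    {s : ι → ℝ} {s₀ : ℝ} (hs : Tendsto s F (𝓝 s₀)) (hs₀ : s₀ ≤ 0)
    (h : ∀ᶠ i in F, K * ‖y i - z‖ ^ 2 ≤ s i) : Tendsto y F (𝓝 z) := by
  rcases F.eq_or_neBot with rfl | hF
  · exact tendsto_bot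
  have h0 : s₀ = 0 := le_antisymm hs₀ (ge_of_tendsto hs (h.mono fun i hi =>
    (by positivity : 0 ≤ K * ‖y i - z‖ ^ 2).trans hi))
  rw [tendsto_iff_norm_sub_tendsto_zero]
  have h1 : Tendsto (fun i => √(s i / K)) F (𝓝 0) := by
    have := ((hs.div_const K).sqrt)
    rwa [h0, zero_div, Real.sqrt_zero] at this
  refine squeeze_zero' (Eventually.of_forall fun _ => norm_nonneg _) (h.mono fun i hi => ?_) h1
  refine Real.le_sqrt_of_sq_le ?_
  rw [le_div_iff₀ hK]
  linarith

variable {V : Type*} [NormedAddCommGroup V] [InnerProductSpace ℝ V] [CompleteSpace V]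

/-- Zarantonello's theorem: a strongly monotone Lipschitz operator on a Hilbert space is
bijective. -/
theorem existsUnique_eq_of_stronglyMonotone {F : V → V} {K L : ℝ} (hK : 0 < K)
    (hL : ∀ x y, ‖F x - F y‖ ≤ L * ‖x - y‖)
    (hF : ∀ x y, K * ‖x - y‖ ^ 2 ≤ inner ℝ (F x - F y) (x - y)) (b : V) : ∃! x, F x = b := by
  -- Enlarging the Lipschitz constant makes it positive and gives K ≤ M, so that 1 - K²/M² ≥ 0.
  set M := max L K with hMdef
  have hKM : K ≤ M := le_max_right _ _
  have hM : 0 < M := hK.trans_le hKM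
  have hFM : ∀ x y, ‖F x - F y‖ ≤ M * ‖x - y‖ := fun x y =>
    (hL x y).trans (mul_le_mul_of_nonneg_right (le_max_left _ _) (norm_nonneg _))
  -- This t minimizes 1 - 2tK + t²M², the bound for the squared contraction factor of x ↦ x - t(F x
  -- - b).
  set t := K / M ^ 2 with ht
  have ht0 : 0 < t := by positivity
  set q : NNReal := ⟨√(1 - K ^ 2 / M ^ 2), Real.sqrt_nonneg _⟩ with hq
  have hle : 0 ≤ 1 - K ^ 2 / M ^ 2 := by
    rw [sub_nonneg, div_le_one (by positivity)]
    exact pow_le_pow_left₀ hK.le hKM 2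
  have hq1 : q < 1 := by
    rw [← NNReal.coe_lt_coe]
    change √(1 - K ^ 2 / M ^ 2) < 1
    rw [Real.sqrt_lt' one_pos]
    have : 0 < K ^ 2 / M ^ 2 := by positivity
    linarith
  have hcontr : ContractingWith q fun x => x - t • (F x - b) := by
    refine ⟨hq1, LipschitzWith.of_dist_le_mul fun x y => ?_⟩
    rw [dist_eq_norm, dist_eq_norm]
    have heq : x - t • (F x - b) - (y - t • (F y - b)) = (x - y) - t • (F x - F y) := by
      module
    rw [heq]
    change _ ≤ √(1 - K ^ 2 / M ^ 2) * ‖x - y‖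
    refine abs_le_of_sq_le_sq' ?_ (by positivity) |>.2
    rw [mul_pow, Real.sq_sqrt hle, norm_sub_sq_real, norm_smul, inner_smul_right, mul_pow,
      Real.norm_eq_abs, sq_abs, real_inner_comm]
    have h1 := mul_le_mul_of_nonneg_left (hF x y) ht0.le
    have h2 : ‖F x - F y‖ ^ 2 ≤ M ^ 2 * ‖x - y‖ ^ 2 := by
      rw [← mul_pow]
      exact pow_le_pow_left₀ (norm_nonneg _) (hFM x y) 2
    have h3 := mul_le_mul_of_nonneg_left h2 (sq_nonneg t)
    have h4 : t ^ 2 * M ^ 2 = t * K := by rw [ht]; field_simp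
    have h5 : K ^ 2 / M ^ 2 = t * K := by rw [ht]; ring
    rw [← mul_assoc, h4] at h3
    rw [h5]
    linarith
  refine ⟨hcontr.fixedPoint, ?_, fun y hy => ?_⟩
  · have h := hcontr.fixedPoint_isFixedPt
    have h' : t • (F (hcontr.fixedPoint) - b) = 0 := sub_eq_self.mp h
    exact sub_eq_zero.mp ((smul_eq_zero.mp h').resolve_left ht0.ne')
  · exact hcontr.fixedPoint_unique (by change y - t • (F y - b) = y; simp [hy])

/-- A family that is bounded along an ultrafilter converges weakly along it. -/
theorem exists_weak_limit_of_ultrafilter {ι : Type*} (U : Ultrafilter ι) {y : ι → V} {R : ℝ}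
    (hR : ∀ᶠ i in (U : Filter ι), ‖y i‖ ≤ R) :
    ∃ z : V, ∀ g : V →L[ℝ] ℝ, Tendsto (fun i => g (y i)) U (𝓝 (g z)) := by
  let D : ι → WeakDual ℝ V := fun i =>
    StrongDual.toWeakDual (InnerProductSpace.toDual ℝ V (y i))
  -- Banach–Alaoglu, carried over to V by the Riesz isometry.
  have hc := WeakDual.isCompact_closedBall (𝕜 := ℝ) (0 : StrongDual ℝ V) R
  have hmem : ((U.map D : Ultrafilter _) : Filter (WeakDual ℝ V))
      ≤ 𝓟 (WeakDual.toStrongDual ⁻¹' Metric.closedBall (0 : StrongDual ℝ V) R) := by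
    rw [le_principal_iff]
    change ∀ᶠ i in (U : Filter ι), D i ∈ _
    filter_upwards [hR] with i hi
    change InnerProductSpace.toDual ℝ V (y i) ∈ Metric.closedBall (0 : StrongDual ℝ V) R
    simpa using hi
  obtain ⟨l, -, hl⟩ := hc.ultrafilter_le_nhds _ hmem
  have hl' : Tendsto D U (𝓝 l) := hl
  refine ⟨(InnerProductSpace.toDual ℝ V).symm (WeakDual.toStrongDual l), fun g => ?_⟩
  have hg : ∀ x, g x = inner ℝ x ((InnerProductSpace.toDual ℝ V).symm g) := fun x => by
    rw [real_inner_comm, InnerProductSpace.toDual_symm_apply]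
  simp only [hg, InnerProductSpace.toDual_symm_apply]
  exact ((WeakDual.eval_continuous _).tendsto l).comp hl'

end Hilbert

/-! ### Superposition operators on L² -/

section L2

variable {α : Type*} [MeasurableSpace α] {μ : Measure α}

theorem real_L2_inner_eq_integral (u v : Lp ℝ 2 μ) : inner ℝ u v = ∫ x, u x * v x ∂μ := by
  rw [L2.inner_def]
  exact integral_congr_ae (Eventually.of_forall fun x => mul_comm _ _)

theorem real_L2_integrable_mul (u v : Lp ℝ 2 μ) : Integrable (fun x => u x * v x) μ :=
  (Lp.memLp u).integrable_mul (Lp.memLp v)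

theorem real_L2_inner_le_mul_inner {u v u' v' : Lp ℝ 2 μ} {c : ℝ}
    (h : ∀ᵐ x ∂μ, u x * v x ≤ c * (u' x * v' x)) :
    inner ℝ u v ≤ c * inner ℝ u' v' := by
  rw [real_L2_inner_eq_integral, real_L2_inner_eq_integral, ← integral_const_mul]
  exact integral_mono_ae (real_L2_integrable_mul u v) ((real_L2_integrable_mul u' v').const_mul c) h

variable [IsFiniteMeasure μ]

theorem LipschitzWith.memLp_comp_Lp {β : ℝ → ℝ} (hβ : LipschitzWith 1 β) (u : Lp ℝ 2 μ) :
    MemLp (fun x => β (u x)) 2 μ := by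
  -- β(0) may be nonzero; the constant is split off and lies in L² because the measure is finite.
  have h1 : LipschitzWith 1 fun t => β t - β 0 := by
    simpa using hβ.sub (LipschitzWith.const (β 0))
  have h2 := (h1.comp_memLp (sub_self _) (Lp.memLp u)).add (memLp_const (β 0))
  refine h2.congr_norm ?_ (Eventually.of_forall fun x => by simp)
  exact hβ.continuous.comp_aestronglyMeasurable (Lp.aestronglyMeasurable u)

/-- The superposition operator of a nonexpansive function on `L²` of a finite measure. -/
noncomputable def nemytskii {β : ℝ → ℝ} (hβ : LipschitzWith 1 β) (u : Lp ℝ 2 μ) : Lp ℝ 2 μ :=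
  (hβ.memLp_comp_Lp u).toLp

theorem coeFn_nemytskii {β : ℝ → ℝ} (hβ : LipschitzWith 1 β) (u : Lp ℝ 2 μ) :
    nemytskii hβ u =ᵐ[μ] fun x => β (u x) :=
  MemLp.coeFn_toLp _

theorem norm_nemytskii_sub_le {β : ℝ → ℝ} (hβ : LipschitzWith 1 β) (u v : Lp ℝ 2 μ) :
    ‖nemytskii hβ u - nemytskii hβ v‖ ≤ ‖u - v‖ := by
  refine Lp.norm_le_norm_of_ae_le ?_
  filter_upwards [Lp.coeFn_sub (nemytskii hβ u) (nemytskii hβ v), Lp.coeFn_sub u v,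
    coeFn_nemytskii hβ u, coeFn_nemytskii hβ v] with x h1 h2 h3 h4
  rw [h1, h2, Pi.sub_apply, Pi.sub_apply, h3, h4]
  simpa [Real.dist_eq] using hβ.dist_le_mul (u x) (v x)

theorem inner_nemytskii_sub_nonneg {β : ℝ → ℝ} (hβ : LipschitzWith 1 β) (hmono : Monotone β)
    (u v : Lp ℝ 2 μ) : 0 ≤ inner ℝ (nemytskii hβ u - nemytskii hβ v) (u - v) := by
  rw [real_L2_inner_eq_integral]
  refine integral_nonneg_of_ae ?_
  filter_upwards [Lp.coeFn_sub (nemytskii hβ u) (nemytskii hβ v), Lp.coeFn_sub u v,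
    coeFn_nemytskii hβ u, coeFn_nemytskii hβ v] with x h1 h2 h3 h4
  rw [h1, h2, Pi.sub_apply, Pi.sub_apply, h3, h4, Pi.zero_apply]
  rcases le_total (u x) (v x) with h | h
  · exact mul_nonneg_of_nonpos_of_nonpos (sub_nonpos.2 (hmono h)) (sub_nonpos.2 h)
  · exact mul_nonneg (sub_nonneg.2 (hmono h)) (sub_nonneg.2 h)

theorem lipschitzWith_max_zero : LipschitzWith 1 fun t : ℝ => max 0 t :=
  LipschitzWith.id.const_max 0

theorem monotone_max_zero : Monotone fun t : ℝ => max 0 t :=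
  fun _ _ h => max_le_max le_rfl h

/-- A function in `L²` with nonpositive integral against every nonnegative function in `L²` is
nonpositive almost everywhere. -/
theorem ae_nonpos_of_forall_inner_nonpos (u : Lp ℝ 2 μ)
    (h : ∀ g : Lp ℝ 2 μ, (∀ᵐ x ∂μ, 0 ≤ g x) → inner ℝ u g ≤ 0) : ∀ᵐ x ∂μ, u x ≤ 0 := by
  -- Testing with the positive part of u works because it satisfies p² = u p pointwise.
  set p := nemytskii lipschitzWith_max_zero u with hp
  have hpe : p =ᵐ[μ] fun x => max 0 (u x) := coeFn_nemytskii lipschitzWith_max_zero u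
  have h1 : inner ℝ p p ≤ 1 * inner ℝ u p := by
    refine real_L2_inner_le_mul_inner ?_
    filter_upwards [hpe] with x hx
    rw [hx]
    rcases le_total 0 (u x) with h | h <;> simp [h]
  have h2 := h p (by filter_upwards [hpe] with x hx; rw [hx]; exact le_max_left _ _)
  have h3 : p = 0 := by
    rw [real_inner_self_eq_norm_sq] at h1
    have : ‖p‖ ^ 2 = 0 := le_antisymm (by linarith) (sq_nonneg _)
    simpa using this
  filter_upwards [hpe, Lp.coeFn_zero ℝ 2 μ] with x hx hx0
  rw [h3, hx0] at hx
  exact (le_max_right _ _).trans hx.symm.le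

end L2

/-! ### The penalized equation and its limits in Hilbert space -/

section Penalization

variable {α : Type*} [MeasurableSpace α] {μ : Measure α}
  {V : Type*} [NormedAddCommGroup V] [InnerProductSpace ℝ V]

/-- `y` solves `B(y, v) + (β(lam + c (T y - φ)), T v) = (f, T v)` for all `v`. -/
def IsPenalizedSolution (B : V →L[ℝ] V →L[ℝ] ℝ) (T : V →L[ℝ] Lp ℝ 2 μ) (φ f lam : Lp ℝ 2 μ)
    (β : ℝ → ℝ) (c : ℝ) (y : V) : Prop :=
  ∀ v, B y v + ∫ x, β (lam x + c * (T y x - φ x)) * T v x ∂μ = ∫ x, f x * T v x ∂μ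

variable {B : V →L[ℝ] V →L[ℝ] ℝ} {T : V →L[ℝ] Lp ℝ 2 μ} {φ f lam : Lp ℝ 2 μ} {β : ℝ → ℝ} {c K : ℝ}

theorem coeFn_add_smul_sub (lam w φ : Lp ℝ 2 μ) (c : ℝ) :
    (lam + c • (w - φ) : Lp ℝ 2 μ) =ᵐ[μ] fun x => lam x + c * (w x - φ x) := by
  filter_upwards [Lp.coeFn_add lam (c • (w - φ)), Lp.coeFn_smul c (w - φ), Lp.coeFn_sub w φ]
    with x h1 h2 h3
  rw [h1, Pi.add_apply, h2, Pi.smul_apply, h3, Pi.sub_apply, smul_eq_mul]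

variable [IsFiniteMeasure μ]

theorem coeFn_nemytskii_add_smul_sub (hβ : LipschitzWith 1 β) (lam w φ : Lp ℝ 2 μ) (c : ℝ) :
    nemytskii hβ (lam + c • (w - φ)) =ᵐ[μ] fun x => β (lam x + c * (w x - φ x)) := by
  filter_upwards [coeFn_nemytskii hβ (lam + c • (w - φ)), coeFn_add_smul_sub lam w φ c]
    with x h1 h2
  rw [h1, h2]

theorem isPenalizedSolution_iff (hβ : LipschitzWith 1 β) {y : V} :
    IsPenalizedSolution B T φ f lam β c y ↔
      ∀ v, B y v + inner ℝ (nemytskii hβ (lam + c • (T y - φ))) (T v) = inner ℝ f (T v) := by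
  refine forall_congr' fun v => ?_
  rw [real_L2_inner_eq_integral, real_L2_inner_eq_integral]
  have : ∫ x, nemytskii hβ (lam + c • (T y - φ)) x * T v x ∂μ
      = ∫ x, β (lam x + c * (T y x - φ x)) * T v x ∂μ := by
    refine integral_congr_ae ?_
    filter_upwards [coeFn_nemytskii_add_smul_sub hβ lam (T y) φ c] with x hx
    rw [hx]
  rw [this]

/-- Riesz representation and the adjoint of T turn the equation into F y = T*f. Coercivity of B
makes F strongly monotone; the penalty contributes a nonnegative term, as its arguments differ by c
T(x - y) with c > 0. -/
theorem existsUnique_isPenalizedSolution [CompleteSpace V] (hK : 0 < K)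
    (hB : ∀ y, K * ‖y‖ ^ 2 ≤ B y y) (hβ : LipschitzWith 1 β) (hmono : Monotone β) (hc : 0 < c) :
    ∃! y, IsPenalizedSolution B T φ f lam β c y := by
  let N : V → Lp ℝ 2 μ := fun y => nemytskii hβ (lam + c • (T y - φ))
  have hN : ∀ x y, (lam + c • (T x - φ)) - (lam + c • (T y - φ)) = c • T (x - y) := fun x y => by
    rw [map_sub]; module
  let F : V → V := fun y => (InnerProductSpace.toDual ℝ V).symm (B y) + T.adjoint (N y)
  have hF : ∀ y v, inner ℝ (F y) v = B y v + inner ℝ (N y) (T v) := fun y v => by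
    rw [inner_add_left, InnerProductSpace.toDual_symm_apply, ContinuousLinearMap.adjoint_inner_left]
  have hsol : ∀ y, F y = T.adjoint f ↔ IsPenalizedSolution B T φ f lam β c y := fun y => by
    rw [isPenalizedSolution_iff hβ, ext_iff_inner_right ℝ]
    refine forall_congr' fun v => ?_
    rw [hF, ContinuousLinearMap.adjoint_inner_left]
  have hFsub : ∀ x y, F x - F y
      = (InnerProductSpace.toDual ℝ V).symm (B (x - y)) + T.adjoint (N x - N y) := fun x y => by
    simp only [F, map_sub]; abel
  have key : ∃! y, F y = T.adjoint f := by
    refine existsUnique_eq_of_stronglyMonotone (L := ‖B‖ + ‖T.adjoint‖ * (c * ‖T‖)) hK ?_ ?_ _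
    · intro x y
      rw [hFsub, add_mul]
      refine (norm_add_le _ _).trans (add_le_add ?_ ?_)
      · rw [LinearIsometryEquiv.norm_map]
        exact B.le_opNorm _
      · refine (T.adjoint.le_opNorm _).trans ?_
        rw [mul_assoc]
        refine mul_le_mul_of_nonneg_left ?_ (norm_nonneg _)
        refine (norm_nemytskii_sub_le hβ _ _).trans ?_
        rw [hN, norm_smul, Real.norm_of_nonneg hc.le, mul_assoc]
        exact mul_le_mul_of_nonneg_left (T.le_opNorm _) hc.le
    · intro x y
      rw [hFsub, inner_add_left, InnerProductSpace.toDual_symm_apply,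
        ContinuousLinearMap.adjoint_inner_left]
      have h := inner_nemytskii_sub_nonneg hβ hmono (lam + c • (T x - φ)) (lam + c • (T y - φ))
      rw [hN, inner_smul_right] at h
      have h' : 0 ≤ inner ℝ (N x - N y) (T (x - y)) := nonneg_of_mul_nonneg_right h hc
      linarith [hB (x - y)]
  simpa only [hsol] using key

/-- Solutions of the penalized equation depend continuously on the penalty function in the sup
norm. -/
theorem norm_sub_le_of_isPenalizedSolution {β' : ℝ → ℝ} (hB : ∀ y, K * ‖y‖ ^ 2 ≤ B y y)
    (hβ : LipschitzWith 1 β) (hβ' : LipschitzWith 1 β') (hmono : Monotone β) (hc : 0 < c)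
    {ε : ℝ} (hε : 0 ≤ ε) (hββ' : ∀ t, |β t - β' t| ≤ ε) {y y' : V}
    (hy : IsPenalizedSolution B T φ f lam β c y) (hy' : IsPenalizedSolution B T φ f lam β' c y') :
    K * ‖y - y'‖ ≤ ε * (μ.real Set.univ) ^ (1 / 2 : ℝ) * ‖T‖ := by
  rw [isPenalizedSolution_iff hβ] at hy
  rw [isPenalizedSolution_iff hβ'] at hy'
  set s := lam + c • (T y - φ) with hs
  set s' := lam + c • (T y' - φ) with hs'
  have hss : s - s' = c • T (y - y') := by rw [hs, hs', map_sub]; module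
  have h1 : 0 ≤ inner ℝ (nemytskii hβ s - nemytskii hβ s') (T (y - y')) := by
    have h := inner_nemytskii_sub_nonneg hβ hmono s s'
    rw [hss, inner_smul_right] at h
    exact nonneg_of_mul_nonneg_right h hc
  have h2 : ‖nemytskii hβ s' - nemytskii hβ' s'‖ ≤ ε * (μ.real Set.univ) ^ (1 / 2 : ℝ) := by
    have h := Lp.norm_le_of_ae_bound (p := 2) (f := nemytskii hβ s' - nemytskii hβ' s') hε (by
      filter_upwards [Lp.coeFn_sub (nemytskii hβ s') (nemytskii hβ' s'), coeFn_nemytskii hβ s',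
        coeFn_nemytskii hβ' s'] with x h1 h2 h3
      rw [h1, Pi.sub_apply, h2, h3]
      exact hββ' _)
    have e : ((2 : ℝ≥0∞).toReal⁻¹) = (1 / 2 : ℝ) := by norm_num
    rw [e, mul_comm] at h
    exact h
  -- Inserting β(s') splits β(s) - β'(s') into a part with a sign, by monotonicity, and a part
  -- bounded by ε.
  have h3 : B (y - y') (y - y') = - inner ℝ (nemytskii hβ s - nemytskii hβ s') (T (y - y'))
      - inner ℝ (nemytskii hβ s' - nemytskii hβ' s') (T (y - y')) := by
    have e1 := hy (y - y')
    have e2 := hy' (y - y')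
    rw [map_sub B, sub_apply, inner_sub_left, inner_sub_left]
    linarith
  have h4 : K * ‖y - y'‖ ^ 2 ≤ ε * (μ.real Set.univ) ^ (1 / 2 : ℝ) * ‖T‖ * ‖y - y'‖ := by
    have h5 := abs_real_inner_le_norm (nemytskii hβ s' - nemytskii hβ' s') (T (y - y'))
    have h6 : ‖nemytskii hβ s' - nemytskii hβ' s'‖ * ‖T (y - y')‖
        ≤ ε * (μ.real Set.univ) ^ (1 / 2 : ℝ) * (‖T‖ * ‖y - y'‖) :=
      mul_le_mul h2 (T.le_opNorm _) (norm_nonneg _) (by positivity)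
    linarith [hB (y - y'), neg_abs_le (inner ℝ (nemytskii hβ s' - nemytskii hβ' s') (T (y - y')))]
  rcases (norm_nonneg (y - y')).eq_or_lt with h0 | h0
  · rw [← h0, mul_zero]; positivity
  · refine le_of_mul_le_mul_right ?_ h0
    linarith

theorem inner_nemytskii_max_le {l w y : Lp ℝ 2 μ} (hc : 0 < c) (hl : ∀ᵐ x ∂μ, 0 ≤ l x)
    (hy : ∀ᵐ x ∂μ, y x ≤ φ x) (hly : ∀ᵐ x ∂μ, l x * (y x - φ x) = 0) :
    inner ℝ (nemytskii lipschitzWith_max_zero (lam + c • (w - φ)) - l)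
        (nemytskii lipschitzWith_max_zero (lam + c • (w - φ)) - lam)
      ≤ c * inner ℝ (nemytskii lipschitzWith_max_zero (lam + c • (w - φ)) - l) (w - y) := by
  refine real_L2_inner_le_mul_inner ?_
  filter_upwards [coeFn_nemytskii_add_smul_sub lipschitzWith_max_zero lam w φ c, hl, hy, hly,
    Lp.coeFn_sub (nemytskii lipschitzWith_max_zero (lam + c • (w - φ))) l,
    Lp.coeFn_sub (nemytskii lipschitzWith_max_zero (lam + c • (w - φ))) lam,
    Lp.coeFn_sub w y] with x h1 h2 h3 h4 h5 h6 h7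
  rw [h5, h6, h7, Pi.sub_apply, Pi.sub_apply, Pi.sub_apply, h1]
  exact max_sub_mul_le rfl hc h2 h3 h4

theorem neg_le_inner_nemytskii_max {l w y : Lp ℝ 2 μ} (hc : 0 < c) (hl : ∀ᵐ x ∂μ, 0 ≤ l x)
    (hy : ∀ᵐ x ∂μ, y x ≤ φ x) (hly : ∀ᵐ x ∂μ, l x * (y x - φ x) = 0) :
    -(‖l - lam‖ ^ 2 / 4 / c)
      ≤ inner ℝ (nemytskii lipschitzWith_max_zero (lam + c • (w - φ)) - l) (w - y) := by
  have h1 := inner_nemytskii_max_le (lam := lam) (w := w) hc hl hy hly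
  have h2 := neg_norm_sub_sq_le_inner
    (nemytskii lipschitzWith_max_zero (lam + c • (w - φ))) l lam
  rw [← neg_div, div_le_iff₀ hc]
  linarith

/-- Subtracting the two equations and testing with y_c - y leaves B(y_c - y, y_c - y) = -(P_c - l,
T(y_c - y)), which is at most ‖l - lam‖²/(4c). -/
theorem tendsto_of_complementarity (hK : 0 < K) (hB : ∀ y, K * ‖y‖ ^ 2 ≤ B y y) {yc : ℝ → V}
    (hyc : ∀ c, 0 < c → IsPenalizedSolution B T φ f lam (fun t => max 0 t) c (yc c)) {y : V}
    {l : Lp ℝ 2 μ} (hy : ∀ v, B y v + inner ℝ l (T v) = inner ℝ f (T v))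
    (hl : ∀ᵐ x ∂μ, 0 ≤ l x) (hyφ : ∀ᵐ x ∂μ, T y x ≤ φ x)
    (hly : ∀ᵐ x ∂μ, l x * (T y x - φ x) = 0) : Tendsto yc atTop (𝓝 y) := by
  refine tendsto_of_sq_le hK (s := fun c => ‖l - lam‖ ^ 2 / 4 / c)
    (tendsto_const_nhds.div_atTop tendsto_id) le_rfl ?_
  filter_upwards [eventually_gt_atTop 0] with c hc
  have h1 := (isPenalizedSolution_iff lipschitzWith_max_zero).1 (hyc c hc) (yc c - y)
  have h2 := hy (yc c - y)
  have h3 := neg_le_inner_nemytskii_max (lam := lam) (w := T (yc c)) hc hl hyφ hly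
  rw [← map_sub, inner_sub_left] at h3
  have h4 := hB (yc c - y)
  rw [map_sub B, sub_apply] at h4
  linarith

theorem tendsto_of_variationalInequality [CompleteSpace V] (hK : 0 < K)
    (hB : ∀ y, K * ‖y‖ ^ 2 ≤ B y y) {yc : ℝ → V}
    (hyc : ∀ c, 0 < c → IsPenalizedSolution B T φ f lam (fun t => max 0 t) c (yc c)) {y : V}
    (hyφ : ∀ᵐ x ∂μ, T y x ≤ φ x)
    (hy : ∀ v, (∀ᵐ x ∂μ, T v x ≤ φ x) → inner ℝ f (T (v - y)) ≤ B y (v - y)) :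
    Tendsto yc atTop (𝓝 y) := by
  let ℓ : V →L[ℝ] ℝ := (innerSL ℝ f).comp T - B y
  have hℓ : ∀ v, ℓ v = inner ℝ f (T v) - B y v := fun v => rfl
  let P : ℝ → Lp ℝ 2 μ := fun c => nemytskii lipschitzWith_max_zero (lam + c • (T (yc c) - φ))
  -- The zero function is an admissible l in the estimates above, whatever y ≤ φ is.
  have h0 : ∀ᵐ x ∂μ, (0 : Lp ℝ 2 μ) x = 0 := by
    filter_upwards [Lp.coeFn_zero ℝ 2 μ] with x hx
    rw [hx, Pi.zero_apply]
  have hl : ∀ᵐ x ∂μ, 0 ≤ (0 : Lp ℝ 2 μ) x := h0.mono fun x hx => hx.ge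
  have hly : ∀ᵐ x ∂μ, (0 : Lp ℝ 2 μ) x * (T y x - φ x) = 0 :=
    h0.mono fun x hx => by rw [hx, zero_mul]
  have heq : ∀ c, 0 < c → B (yc c - y) (yc c - y) + inner ℝ (P c) (T (yc c - y))
      = ℓ (yc c - y) := fun c hc => by
    have h1 := (isPenalizedSolution_iff lipschitzWith_max_zero).1 (hyc c hc) (yc c - y)
    rw [hℓ, map_sub B, sub_apply]
    linarith
  have hsq : ∀ c, 0 < c → K * ‖yc c - y‖ ^ 2 ≤ ℓ (yc c - y) + ‖lam‖ ^ 2 / 4 / c := fun c hc => by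
    have h3 := neg_le_inner_nemytskii_max (lam := lam) (w := T (yc c)) hc hl hyφ hly
    rw [← map_sub, sub_zero, zero_sub, norm_neg] at h3
    linarith [heq c hc, hB (yc c - y)]
  obtain ⟨R, hR⟩ : ∃ R, ∀ c, 1 ≤ c → ‖yc c - y‖ ≤ R := by
    -- The summand 1 forces the norm above 1 in the contradiction, so the constant term is absorbed
    -- by its multiple with the norm.
    refine ⟨(‖ℓ‖ + ‖lam‖ ^ 2 / 4) / K + 1, fun c hc => ?_⟩
    by_contra! hlt
    have h1 := hsq c (by linarith)
    have h2 : ℓ (yc c - y) ≤ ‖ℓ‖ * ‖yc c - y‖ := (le_abs_self _).trans (ℓ.le_opNorm _)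
    have h3 : ‖lam‖ ^ 2 / 4 / c ≤ ‖lam‖ ^ 2 / 4 := div_le_self (by positivity) hc
    have h4 : 0 ≤ (‖ℓ‖ + ‖lam‖ ^ 2 / 4) / K := by positivity
    have h5 : (‖ℓ‖ + ‖lam‖ ^ 2 / 4) / K < ‖yc c - y‖ := by linarith
    rw [div_lt_iff₀ hK] at h5
    have h6 : 1 < ‖yc c - y‖ := by linarith
    have h7 : 0 ≤ ‖lam‖ ^ 2 / 4 := by positivity
    nlinarith
  -- The penalty may blow up, but only like √c: (P_c, P_c - lam) ≤ c(P_c, T(y_c - y)) ≤ c‖ℓ‖R, and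
  -- Young's inequality absorbs (P_c, lam).
  have hP : ∀ c, 1 ≤ c → ‖P c‖ ^ 2 ≤ ‖lam‖ ^ 2 + 2 * c * (‖ℓ‖ * R) := fun c hc => by
    have hc0 : 0 < c := by linarith
    have h1 := inner_nemytskii_max_le (lam := lam) (w := T (yc c)) hc0 hl hyφ hly
    rw [← map_sub, sub_zero] at h1
    change inner ℝ (P c) (P c - lam) ≤ c * inner ℝ (P c) (T (yc c - y)) at h1
    rw [inner_sub_right, real_inner_self_eq_norm_sq] at h1
    have h2 : inner ℝ (P c) (T (yc c - y)) ≤ ‖ℓ‖ * R := by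
      have h3 : ℓ (yc c - y) ≤ ‖ℓ‖ * ‖yc c - y‖ := (le_abs_self _).trans (ℓ.le_opNorm _)
      have h4 := mul_le_mul_of_nonneg_left (hR c hc) (norm_nonneg ℓ)
      have h5 : 0 ≤ K * ‖yc c - y‖ ^ 2 := by positivity
      linarith [heq c hc0, hB (yc c - y)]
    have h3 := mul_le_mul_of_nonneg_left h2 hc0.le
    have h4 := real_inner_le_norm (P c) lam
    nlinarith [sq_nonneg (‖P c‖ - ‖lam‖)]
  have hPc : Tendsto (fun c => ‖P c‖ / c) atTop (𝓝 0) := by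
    have h1 : Tendsto (fun c : ℝ => √(‖lam‖ ^ 2 / c / c + 2 * (‖ℓ‖ * R) / c)) atTop (𝓝 0) := by
      have e1 : Tendsto (fun c : ℝ => ‖lam‖ ^ 2 / c / c) atTop (𝓝 0) :=
        (tendsto_const_nhds.div_atTop tendsto_id).div_atTop tendsto_id
      have e2 : Tendsto (fun c : ℝ => 2 * (‖ℓ‖ * R) / c) atTop (𝓝 0) :=
        tendsto_const_nhds.div_atTop tendsto_id
      simpa using (e1.add e2).sqrt
    refine squeeze_zero' ?_ ?_ h1
    · filter_upwards [eventually_ge_atTop 0] with c hc using by positivity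
    · filter_upwards [eventually_ge_atTop 1] with c hc
      have hc0 : 0 < c := by linarith
      refine Real.le_sqrt_of_sq_le ?_
      rw [div_pow, div_le_iff₀ (by positivity)]
      refine (hP c hc).trans (le_of_eq ?_)
      field_simp
  -- Along an ultrafilter a bounded family has a weak limit, so no subsequences are needed.
  rw [tendsto_iff_ultrafilter]
  intro U hU
  have hU1 : ∀ᶠ c in (U : Filter ℝ), (1 : ℝ) ≤ c := hU (eventually_ge_atTop 1)
  obtain ⟨z, hz⟩ := exists_weak_limit_of_ultrafilter U (y := yc) (R := R + ‖y‖) (by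
    filter_upwards [hU1] with c hc
    calc ‖yc c‖ = ‖(yc c - y) + y‖ := by rw [sub_add_cancel]
      _ ≤ R + ‖y‖ := (norm_add_le _ _).trans (add_le_add_left (hR c hc) _))
  -- Pointwise T y_c - φ ≤ (P_c - lam)/c, and the right side tends to 0 in L²; testing with g ≥ 0
  -- carries this to the weak limit.
  have hzφ : ∀ᵐ x ∂μ, T z x ≤ φ x := by
    have h1 : ∀ᵐ x ∂μ, (T z - φ : Lp ℝ 2 μ) x ≤ 0 := by
      refine ae_nonpos_of_forall_inner_nonpos _ fun g hg => ?_
      have hlim : Tendsto (fun c => inner ℝ (T (yc c) - φ) g) U (𝓝 (inner ℝ (T z - φ) g)) := by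
        have := (hz ((innerSL ℝ g).comp T)).sub_const (inner ℝ g φ)
        simp only [real_inner_comm g]
        simpa only [ContinuousLinearMap.comp_apply, innerSL_apply_apply, ← inner_sub_right]
          using this
      have hlim' : Tendsto (fun c => ‖P c‖ / c * ‖g‖ + ‖lam‖ * ‖g‖ / c) U (𝓝 0) := by
        have := (hPc.mul_const ‖g‖).add
          ((tendsto_const_nhds (x := ‖lam‖ * ‖g‖)).div_atTop tendsto_id)
        simp only [zero_mul, add_zero] at this
        exact this.mono_left hU
      refine le_of_tendsto_of_tendsto hlim hlim' ?_
      filter_upwards [hU1] with c hc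
      have hc0 : 0 < c := by linarith
      have h2 : inner ℝ (T (yc c) - φ) g ≤ c⁻¹ * inner ℝ (P c - lam) g := by
        refine real_L2_inner_le_mul_inner ?_
        filter_upwards [hg, Lp.coeFn_sub (T (yc c)) φ, Lp.coeFn_sub (P c) lam,
          coeFn_nemytskii_add_smul_sub lipschitzWith_max_zero lam (T (yc c)) φ c]
          with x e1 e2 e3 e4
        have e4' : P c x = max 0 (lam x + c * (T (yc c) x - φ x)) := e4
        rw [e2, e3, Pi.sub_apply, Pi.sub_apply, e4', ← mul_assoc]
        refine mul_le_mul_of_nonneg_right ?_ e1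
        rw [inv_mul_eq_div, le_div_iff₀ hc0]
        linarith [le_max_right 0 (lam x + c * (T (yc c) x - φ x))]
      have h3 : inner ℝ (P c - lam) g ≤ (‖P c‖ + ‖lam‖) * ‖g‖ :=
        (real_inner_le_norm _ _).trans
          (mul_le_mul_of_nonneg_right (norm_sub_le _ _) (norm_nonneg _))
      refine h2.trans ((mul_le_mul_of_nonneg_left h3 (inv_nonneg.2 hc0.le)).trans (le_of_eq ?_))
      field_simp
    filter_upwards [h1, Lp.coeFn_sub (T z) φ] with x e1 e2
    rw [e2, Pi.sub_apply] at e1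
    linarith
  refine tendsto_of_sq_le hK (s := fun c => ℓ (yc c - y) + ‖lam‖ ^ 2 / 4 / c)
    (s₀ := ℓ (z - y)) ?_ ?_ ?_
  · have h1 : Tendsto (fun c : ℝ => ‖lam‖ ^ 2 / 4 / c) U (𝓝 0) :=
      (tendsto_const_nhds.div_atTop tendsto_id).mono_left hU
    have h2 := ((hz ℓ).sub_const (ℓ y)).add h1
    simpa only [← map_sub, add_zero] using h2
  · rw [hℓ]
    linarith [hy z hzφ]
  · filter_upwards [hU1] with c hc using hsq c (by linarith)

end Penalization

/-! ### Bilinear forms with bounded coefficients -/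

section MulForm

variable {α : Type*} [MeasurableSpace α] {μ : Measure α}

/-- The bilinear form `(u, v) ↦ ∫ g u v` on `L²` for `g ∈ L^∞`. -/
noncomputable def mulForm (g : Lp ℝ ∞ μ) : Lp ℝ 2 μ →L[ℝ] Lp ℝ 2 μ →L[ℝ] ℝ :=
  ((ContinuousLinearMap.mul ℝ ℝ).lpPairing μ 2 2).comp
    ((ContinuousLinearMap.mul ℝ ℝ).holderL μ ∞ 2 2 g)

theorem coeFn_holder_mul (g : Lp ℝ ∞ μ) (u : Lp ℝ 2 μ) :
    (ContinuousLinearMap.mul ℝ ℝ).holderL μ ∞ 2 2 g u =ᵐ[μ] fun x => g x * u x :=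
  (ContinuousLinearMap.mul ℝ ℝ).coeFn_holder g u

theorem integrable_mul_mul (g : Lp ℝ ∞ μ) (u v : Lp ℝ 2 μ) :
    Integrable (fun x => g x * u x * v x) μ := by
  refine (real_L2_integrable_mul ((ContinuousLinearMap.mul ℝ ℝ).holderL μ ∞ 2 2 g u) v).congr ?_
  filter_upwards [coeFn_holder_mul g u] with x hx
  rw [hx]

theorem mulForm_apply (g : Lp ℝ ∞ μ) (u v : Lp ℝ 2 μ) :
    mulForm g u v = ∫ x, g x * u x * v x ∂μ := by
  have h : mulForm g u v
      = ∫ x, ((ContinuousLinearMap.mul ℝ ℝ).holderL μ ∞ 2 2 g u) x * v x ∂μ :=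
    (ContinuousLinearMap.mul ℝ ℝ).lpPairing_eq_integral _ _
  rw [h]
  refine integral_congr_ae ?_
  filter_upwards [coeFn_holder_mul g u] with x hx
  rw [hx]

end MulForm

/-! ### Sobolev spaces and the elliptic form -/

namespace ObstacleProblem

variable {n : ℕ} {Ω : Opens (EuclideanSpace ℝ (Fin n))}

/-- Boundedness of Ω enters through this finiteness alone: constants lie in L², and sup bounds give
L² bounds. -/
theorem isFiniteMeasure_vol (hΩ : Bornology.IsBounded (Ω : Set (EuclideanSpace ℝ (Fin n)))) :
    IsFiniteMeasure (vol Ω) :=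
  ⟨by rw [Measure.restrict_apply_univ]; exact hΩ.measure_lt_top⟩

/-- The inclusion of `H¹(Ω)` in `L²(Ω)`. -/
noncomputable def fnL : H1 Ω →L[ℝ] L2 Ω :=
  (WithLp.fstL 2 ℝ (L2 Ω) (PiLp 2 fun _ : Fin n => L2 Ω)).comp (H1 Ω).subtypeL

theorem fnL_apply (u : H1 Ω) : fnL u = fn u := rfl

/-- The weak partial derivative as an operator from `H¹(Ω)` to `L²(Ω)`. -/
noncomputable def weakDerivL (i : Fin n) : H1 Ω →L[ℝ] L2 Ω :=
  (PiLp.proj 2 (𝕜 := ℝ) (fun _ : Fin n => L2 Ω) i).comp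
    ((WithLp.sndL 2 ℝ (L2 Ω) (PiLp 2 fun _ : Fin n => L2 Ω)).comp (H1 Ω).subtypeL)

theorem weakDerivL_apply (i : Fin n) (u : H1 Ω) : weakDerivL i u = weakDeriv u i := rfl

/-- Each test function imposes one equation between continuous functionals of the pair. This makes
H¹(Ω) closed in a Hilbert space, hence complete. -/
theorem isClosed_setOf_isWeakPartialDeriv (i : Fin n) :
    IsClosed {p : L2Pair Ω | IsWeakPartialDeriv i p.fst (p.snd i)} := by
  have h : {p : L2Pair Ω | IsWeakPartialDeriv i p.fst (p.snd i)}
      = ⋂ ψ : TestFunction Ω ℝ ⊤, {p | inner ℝ p.fst ((memLp_partialDeriv i ψ).toLp _)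
          = -inner ℝ (p.snd i) ((memLp_testFunction ψ).toLp _)} := by
    ext p
    rw [Set.mem_iInter]
    refine forall_congr' fun ψ => ?_
    rw [Set.mem_ofPred_eq, real_L2_inner_eq_integral, real_L2_inner_eq_integral]
    have key : ∀ (w : L2 Ω) (θ : EuclideanSpace ℝ (Fin n) → ℝ) (hθ : MemLp θ 2 (vol Ω)),
        ∫ x, w x * hθ.toLp θ x ∂(vol Ω) = ∫ x, w x * θ x ∂(vol Ω) := fun w θ hθ => by
      refine integral_congr_ae ?_
      filter_upwards [hθ.coeFn_toLp] with x hx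
      rw [hx]
    rw [key, key]
  rw [h]
  refine isClosed_iInter fun ψ => isClosed_eq ?_ ?_
  · exact (WithLp.fstL 2 ℝ (L2 Ω) (PiLp 2 fun _ : Fin n => L2 Ω)).continuous.inner
      continuous_const
  · exact (((PiLp.proj 2 (𝕜 := ℝ) (fun _ : Fin n => L2 Ω) i).comp
      (WithLp.sndL 2 ℝ (L2 Ω) (PiLp 2 fun _ : Fin n => L2 Ω))).continuous.inner
      continuous_const).neg

instance instCompleteSpaceH1 : CompleteSpace (H1 Ω) := by
  have h : IsClosed (H1 Ω : Set (L2Pair Ω)) := by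
    have e : (H1 Ω : Set (L2Pair Ω))
        = ⋂ i, {p : L2Pair Ω | IsWeakPartialDeriv i p.fst (p.snd i)} := by
      ext p
      rw [Set.mem_iInter]
      rfl
    rw [e]
    exact isClosed_iInter isClosed_setOf_isWeakPartialDeriv
  exact h.completeSpace_coe

/-- The bilinear form of the coefficients as a continuous bilinear form. -/
noncomputable def Coefficients.formL (A : Coefficients Ω) : H1 Ω →L[ℝ] H1 Ω →L[ℝ] ℝ :=
  (∑ i, ∑ j, (mulForm (A.a i j)).bilinearComp (weakDerivL i) (weakDerivL j))
    + (∑ i, ((mulForm (A.d i)).bilinearComp (weakDerivL i) fnL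
        + (mulForm (A.d i)).bilinearComp fnL (weakDerivL i)))
    + (mulForm A.b).bilinearComp fnL fnL

theorem Coefficients.formL_apply (A : Coefficients Ω) (y v : H1 Ω) :
    A.formL y v = A.form y v := by
  have ha : Integrable (fun x => ∑ i, ∑ j, A.a i j x * weakDeriv y i x * weakDeriv v j x)
      (vol Ω) :=
    integrable_finsetSum _ fun i _ => integrable_finsetSum _ fun j _ => integrable_mul_mul _ _ _
  have hd' : ∀ i, Integrable (fun x => A.d i x * (weakDeriv y i x * fn v x
      + fn y x * weakDeriv v i x)) (vol Ω) := fun i => by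
    refine ((integrable_mul_mul (A.d i) (weakDeriv y i) (fn v)).add
      (integrable_mul_mul (A.d i) (fn y) (weakDeriv v i))).congr (Eventually.of_forall fun x => ?_)
    simp only [Pi.add_apply]
    ring
  have hd : Integrable (fun x => ∑ i, A.d i x * (weakDeriv y i x * fn v x
      + fn y x * weakDeriv v i x)) (vol Ω) := integrable_finsetSum _ fun i _ => hd' i
  have hb : Integrable (fun x => A.b x * fn y x * fn v x) (vol Ω) := integrable_mul_mul _ _ _
  rw [Coefficients.form, integral_add (by exact ha.add hd) hb, integral_add ha hd,
    integral_finsetSum _ fun i _ => integrable_finsetSum _ fun j _ => integrable_mul_mul _ _ _,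
    integral_finsetSum _ fun i _ => hd' i]
  simp only [Coefficients.formL, add_apply, _root_.sum_apply,
    ContinuousLinearMap.bilinearComp_apply, fnL_apply, weakDerivL_apply, mulForm_apply]
  congr 2
  · refine Finset.sum_congr rfl fun i _ => ?_
    rw [integral_finsetSum _ fun j _ => integrable_mul_mul _ _ _]
  · refine Finset.sum_congr rfl fun i _ => ?_
    rw [← integral_add (integrable_mul_mul _ _ _) (integrable_mul_mul _ _ _)]
    refine integral_congr_ae (Eventually.of_forall fun x => ?_)
    simp only
    ring

theorem IsSmoothedMax.lipschitzWith {m : ℝ → ℝ → ℝ} (hm : IsSmoothedMax m) {γ : ℝ} (hγ : 0 < γ) :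
    LipschitzWith 1 (m γ) :=
  lipschitzWith_of_nnnorm_deriv_le ((hm.contDiff γ hγ).differentiable one_ne_zero) fun x => by
    rw [← NNReal.coe_le_coe, coe_nnnorm, NNReal.coe_one, Real.norm_of_nonneg (hm.deriv_mem γ hγ x).1]
    exact (hm.deriv_mem γ hγ x).2

theorem IsSmoothedMax.monotone {m : ℝ → ℝ → ℝ} (hm : IsSmoothedMax m) {γ : ℝ} (hγ : 0 < γ) :
    Monotone (m γ) :=
  monotone_of_deriv_nonneg ((hm.contDiff γ hγ).differentiable one_ne_zero)
    fun x => (hm.deriv_mem γ hγ x).1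

end ObstacleProblem

/-- `y ∈ W` solves `B(y, v) + (β(lam + c (T y - φ)), T v) = (f, T v)` for all `v ∈ W`. -/
def IsPenalizedSolutionOn {α : Type*} [MeasurableSpace α] {μ : Measure α} {H : Type*}
    [NormedAddCommGroup H] [InnerProductSpace ℝ H] (W : Submodule ℝ H) (B : H →L[ℝ] H →L[ℝ] ℝ)
    (T : H →L[ℝ] Lp ℝ 2 μ) (φ f lam : Lp ℝ 2 μ) (β : ℝ → ℝ) (c : ℝ) (y : W) : Prop :=
  ∀ v : W, B y v + ∫ x, β (lam x + c * (T (y : H) x - φ x)) * T (v : H) x ∂μ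
    = ∫ x, f x * T (v : H) x ∂μ

/-- The four assertions of the penalization method for a coercive form on a complete subspace. -/
theorem penalization_of_submodule {α : Type*} [MeasurableSpace α] {μ : Measure α}
    [IsFiniteMeasure μ] {H : Type*} [NormedAddCommGroup H] [InnerProductSpace ℝ H] (W : Submodule ℝ H)
    [CompleteSpace W] (B : H →L[ℝ] H →L[ℝ] ℝ) (T : H →L[ℝ] Lp ℝ 2 μ) {K : ℝ} (hK : 0 < K)
    (hB' : ∀ y : W, K * ‖(y : H)‖ ^ 2 ≤ B y y) (φ f lam : Lp ℝ 2 μ)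
    {m : ℝ → ℝ → ℝ} (hm : IsSmoothedMax m) :
    (∀ γ : ℝ, 0 < γ → ∀ c : ℝ, 0 < c → ∃! y : W, IsPenalizedSolutionOn W B T φ f lam (m γ) c y) ∧
    (∀ c : ℝ, 0 < c → ∃! y : W, IsPenalizedSolutionOn W B T φ f lam (fun t => max 0 t) c y) ∧
    (∀ c : ℝ, 0 < c → ∀ (yγ : ℝ → W) (yc : W),
      (∀ γ : ℝ, 0 < γ → IsPenalizedSolutionOn W B T φ f lam (m γ) c (yγ γ)) →
      IsPenalizedSolutionOn W B T φ f lam (fun t => max 0 t) c yc →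
      Tendsto (fun γ => (yγ γ : H)) atTop (𝓝 (yc : H))) ∧
    (∀ yc : ℝ → W,
      (∀ c : ℝ, 0 < c → IsPenalizedSolutionOn W B T φ f lam (fun t => max 0 t) c (yc c)) →
      (∀ y : W, (∀ᵐ x ∂μ, T (y : H) x ≤ φ x) →
        (∀ v : W, (∀ᵐ x ∂μ, T (v : H) x ≤ φ x) →
          ∫ x, f x * T ((v - y : W) : H) x ∂μ ≤ B y ((v - y : W) : H)) →
        Tendsto (fun c => (yc c : H)) atTop (𝓝 (y : H))) ∧
      (∀ (y : W) (l : Lp ℝ 2 μ),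
        (∀ v : W, B y v + ∫ x, l x * T (v : H) x ∂μ = ∫ x, f x * T (v : H) x ∂μ) →
        (∀ᵐ x ∂μ, 0 ≤ l x) → (∀ᵐ x ∂μ, T (y : H) x ≤ φ x) →
        (∀ᵐ x ∂μ, l x * (T (y : H) x - φ x) = 0) →
        Tendsto (fun c => (yc c : H)) atTop (𝓝 (y : H)))) := by
  -- Coercivity is assumed on W only, so W itself serves as the Hilbert space V.
  let B₀ : W →L[ℝ] W →L[ℝ] ℝ := B.bilinearComp W.subtypeL W.subtypeL
  let T₀ : W →L[ℝ] Lp ℝ 2 μ := T.comp W.subtypeL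
  have hB : ∀ y : W, K * ‖y‖ ^ 2 ≤ B₀ y y := hB'
  have hsol : ∀ (β : ℝ → ℝ) (c : ℝ) (y : W),
      IsPenalizedSolutionOn W B T φ f lam β c y ↔ IsPenalizedSolution B₀ T₀ φ f lam β c y :=
    fun β c y => Iff.rfl
  simp only [hsol, ← tendsto_subtype_rng]
  refine ⟨fun γ hγ c hc => existsUnique_isPenalizedSolution hK hB (hm.lipschitzWith hγ)
      (hm.monotone hγ) hc, fun c hc => existsUnique_isPenalizedSolution hK hB
      lipschitzWith_max_zero monotone_max_zero hc, fun c hc yγ yc hyγ hyc => ?_,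
    fun yc hyc => ⟨fun y hyφ hy => ?_, fun y l h1 h2 h3 h4 => ?_⟩⟩
  · obtain ⟨g, hg0, hg, hgm⟩ := hm.approx
    rw [tendsto_iff_norm_sub_tendsto_zero]
    have hlim : Tendsto (fun γ => g γ * μ.real Set.univ ^ (1 / 2 : ℝ)
        * ‖T₀‖ / K) atTop (𝓝 0) := by
      simpa using ((hg.mul_const (μ.real Set.univ ^ (1 / 2 : ℝ))).mul_const
        ‖T₀‖).div_const K
    refine squeeze_zero' (Eventually.of_forall fun _ => norm_nonneg _) ?_ hlim
    filter_upwards [eventually_gt_atTop 0] with γ hγ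
    rw [le_div_iff₀ hK, mul_comm]
    exact norm_sub_le_of_isPenalizedSolution hB (hm.lipschitzWith hγ) lipschitzWith_max_zero
      (hm.monotone hγ) hc (hg0 γ hγ) (hgm γ hγ) (hyγ γ hγ) hyc
  · refine tendsto_of_variationalInequality hK hB hyc hyφ fun v hv => ?_
    rw [real_L2_inner_eq_integral]
    exact hy v hv
  · refine tendsto_of_complementarity hK hB hyc (l := l) (fun v => ?_) h2 h3 h4
    rw [real_L2_inner_eq_integral, real_L2_inner_eq_integral]
    exact h1 v

theorem mainTheorem1 {n : ℕ} (Ω : Opens (EuclideanSpace ℝ (Fin n)))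
    (hΩ : Bornology.IsBounded (Ω : Set (EuclideanSpace ℝ (Fin n))))
    (A : Coefficients Ω) (hA : A.IsElliptic)
    (φ : H1 Ω) (f lam : L2 Ω)
    (m : ℝ → ℝ → ℝ) (hm : IsSmoothedMax m) :
    (∀ γ : ℝ, 0 < γ → ∀ c : ℝ, 0 < c → ∃! y : H10 Ω, SolvesFullyRegularized A φ f lam m γ c y) ∧
    (∀ c : ℝ, 0 < c → ∃! y : H10 Ω, SolvesRegularized A φ f lam c y) ∧
    (∀ c : ℝ, 0 < c → ∀ (yγ : ℝ → H10 Ω) (yc : H10 Ω),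
      (∀ γ : ℝ, 0 < γ → SolvesFullyRegularized A φ f lam m γ c (yγ γ)) →
      SolvesRegularized A φ f lam c yc →
      Tendsto (fun γ => (yγ γ : H1 Ω)) atTop (𝓝 (yc : H1 Ω))) ∧
    (∀ yc : ℝ → H10 Ω, (∀ c : ℝ, 0 < c → SolvesRegularized A φ f lam c (yc c)) →
      (∀ y : H10 Ω, SolvesObstacle A φ f y →
        Tendsto (fun c => (yc c : H1 Ω)) atTop (𝓝 (y : H1 Ω))) ∧
      (∀ (y : H10 Ω) (l : L2 Ω), SolvesComplementarity A φ f y l →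
        Tendsto (fun c => (yc c : H1 Ω)) atTop (𝓝 (y : H1 Ω)))) := by
  have := isFiniteMeasure_vol hΩ
  obtain ⟨K, hK, hB⟩ := hA
  have : CompleteSpace (H10 Ω) :=
    (Submodule.isClosed_topologicalClosure (smoothCompactlySupported Ω)).completeSpace_coe
  have hB' : ∀ y : H10 Ω, K * ‖(y : H1 Ω)‖ ^ 2 ≤ A.formL (y : H1 Ω) (y : H1 Ω) := fun y =>
    (hB y).trans_eq (A.formL_apply y y).symm
  have h := penalization_of_submodule (H := H1 Ω) (H10 Ω) A.formL fnL hK hB' (fn φ) f lam hm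
  have hsol : ∀ (β : ℝ → ℝ) (c : ℝ) (y : H10 Ω), SolvesPenalized A φ f lam β c y ↔
      IsPenalizedSolutionOn (H := H1 Ω) (H10 Ω) A.formL fnL (fn φ) f lam β c y := fun β c y => by
    simp only [SolvesPenalized, IsPenalizedSolutionOn, A.formL_apply, fnL_apply]
  simp only [SolvesFullyRegularized, SolvesRegularized, hsol]
  refine ⟨h.1, h.2.1, h.2.2.1, fun yc hyc => ⟨fun y hy => (h.2.2.2 yc hyc).1 y hy.1 fun v hv => ?_,
    fun y l hy => (h.2.2.2 yc hyc).2 y l (fun v => ?_) hy.2.1 hy.2.2.1 hy.2.2.2⟩⟩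
  · rw [A.formL_apply]
    exact hy.2 v hv
  · rw [A.formL_apply]
    exact hy.1 v
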